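/- **Theorem (tabular $Q$-learning by a four-layer transformer with continuous context tokens).** *Model.* Fix finite $\mathcal S$ and nonempty $\mathcal A=\{a_1,\dots,a_n\}$ and the vocabulary $\mathcal V=\mathcal S\cup\mathcal A\cup\{\mathsf{BOS},r,\mathsf{Select},Q_{\rm curr},Q_{\rm next},\mathsf{Update}\}$ with orthonormal identity embeddings $\tilde u_v\in\mathbb R^{d_{\rm TE}}$. The residual stream is $\mathbb R^{d}$, $d=3d_{\rm TE}+d_{\rm PE}$, with blocks $\mathrm{id},\mathrm{buf}_1,\mathrm{buf}_2,\mathrm{pos}$. A causal transformer $\theta$ adds an absolute positional encoding (supported in the block $\mathrm{pos}$) to its input vectors and then applies layers $h_i\mapsto \mathrm{post}\bigl(h_i+\sum_m W_O^m\sum_{j\le i}w^m_{ij}W_V^m h_j\bigr)$, where $\mathrm{post}$ is the tokenwise block (MLP and normalisation). With the scores $\sigma_{ij}=\langle W_Qh_i,W_Kh_j\rangle$, each head is either linear, $w_{ij}=\sigma_{ij}$, or softmax, $w_{ij}=e^{\beta\sigma_{ij}}/\sum_{k\le i}e^{\beta\sigma_{ik}}$, with inverse temperature $\beta$; for $\beta=\infty$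 the softmax is replaced by its limit, the uniform distribution on the maximisers of $\sigma_{i\cdot}$. Its output is the last-layer vector at the last position. *Run.* A plain token $\langle v\rangle$ has $\mathrm{id}=\tilde u_v$ and all other blocks $0$; the reward token has $\mathrm{id}=\tilde u_r$, $\mathrm{buf}_1=r_t\tilde u_r$. For a table $Q$, the context token $c_a(Q)$ has $\mathrm{id}=\tilde u_a+\tilde u_{\mathsf{Update}}$, $\mathrm{buf}_1=\sum_sQ(s,a)\tilde u_s$ and all other blocks $0$. At step $t$ the model, holding context tokens $(c^t_a)_{a\in\mathcal A}$, reads $$\langle\mathsf{BOS}\rangle\,c^t_{a_1}\cdots c^t_{a_n}\,\langle Q_{\rm curr}\rangle\langle s_t\rangle\langle a_t\rangle\langle r_t\rangle\langle Q_{\rm next}\rangle\langle s_{t+1}\rangle\bigl(\langle s_{t+1}\rangle\langle a_i\rangle\bigr)_{i=1}^{n}\langle\mathsf{Select}\rangle ,$$ its output is decoded to an action $a^*_t$ maximising the logit $\langle\tilde u_a,\mathrm{id}(\cdot)\rangle$ (ties broken arbitrarily), the tokens $\langle a^*_t\rangle\langle\mathsf{Update}\rangle$ are appended, and the whole output vector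 at $\mathsf{Update}$ becomes $c^{t+1}_{a_t}$; $c^{t+1}_a=c^t_a$ for $a\ne a_t$. Initially $c^0_a=c_a(Q_0)$. *Statement.* There is an absolute constant $C$ such that for all such $\mathcal S,\mathcal A$, every learning rate $\alpha\in(0,1]$ and discount $\gamma\in(0,1)$ there is $d_{\rm TE}\le C(|\mathcal S|+|\mathcal A|)$ for which orthonormal embeddings exist and such that, for every choice of them, there are $d_{\rm PE}$ and a transformer $\theta$ with exactly four layers, at most $C$ heads in each, and $\mathrm{post}=\mathrm{identity}$ (so only attention and residual connections), with the following properties. For every MDP on $\mathcal S,\mathcal A$ with rewards $r(s,a)\in[0,1]$, every $Q_0\ge 0$, and every infinite trajectory $(s_t,a_t)$ with $\mathcal P(s_{t+1}\mid s_t,a_t)>0$ and $r_t=r(s_t,a_t)$, let $Q_t$ be given by $$Q_{t+1}(s_t,a_t)=Q_t(s_t,a_t)+\alpha\bigl(r_t+\gamma\max_{a}Q_t(s_{t+1},a)-Q_t(s_t,a_t)\bigr),$$ all other entries being unchanged. 1. In the limit model ($\beta=\infty$), for all $t\ge0$: $c^t_a=c_a(Q_t)$ for every $a$, and $Q_t(s_{t+1},a^*_t)=\max_aQ_t(s_{t+1},a)$.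 2. For every $\varepsilon>0$ there is $\beta_0$ such that for every finite $\beta\ge\beta_0$, with the same $\theta$, and for all such MDPs, $Q_0$, trajectories, decoders and all $t\ge 0$: every coordinate of $c^t_a-c_a(Q_t)$ is at most $\varepsilon$ in absolute value, and $Q_t(s_{t+1},a^*_t)\ge\max_aQ_t(s_{t+1},a)-\varepsilon$. In particular neither $\theta$ nor $\beta_0$ depends on a horizon $T$. -/

import Mathlib

open Matrix

noncomputable section

namespace QTransformer

/-! ### Tabular Q-learning on a finite MDP -/

/-- A finite MDP with state space `Fin nS` and action space `Fin nA`: a transition kernel and a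
deterministic reward with values in `[0, 1]`. The discount factor is a separate parameter. -/
structure FiniteMDP (nS nA : ℕ) where
  P : Fin nS → Fin nA → PMF (Fin nS)
  r : Fin nS → Fin nA → ℝ
  r_nonneg : ∀ s a, 0 ≤ r s a
  r_le_one : ∀ s a, r s a ≤ 1

/-- A state-action sequence all of whose transitions are possible in the MDP
(the behaviour policy is arbitrary). -/
def FiniteMDP.IsTrajectory {nS nA : ℕ} (M : FiniteMDP nS nA)
    (s : ℕ → Fin nS) (a : ℕ → Fin nA) : Prop :=
  ∀ t, M.P (s t) (a t) (s (t + 1)) ≠ 0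

/-- `max_b Q(s, b)`. -/
def maxQ {nS nA : ℕ} [NeZero nA] (Q : Fin nS → Fin nA → ℝ) (s : Fin nS) : ℝ :=
  Finset.univ.sup' Finset.univ_nonempty (Q s)

/-- One Q-learning update along the transition `s, a, r, s'`. -/
def qStep {nS nA : ℕ} [NeZero nA] (α γ : ℝ) (Q : Fin nS → Fin nA → ℝ)
    (s : Fin nS) (a : Fin nA) (r : ℝ) (s' : Fin nS) : Fin nS → Fin nA → ℝ :=
  fun x b => if x = s ∧ b = a then Q s a + α * (r + γ * maxQ Q s' - Q s a) else Q x b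

/-- The Q-tables `Q_0, Q_1, …` produced by Q-learning along a trajectory. -/
def qTable {nS nA : ℕ} [NeZero nA] (α γ : ℝ) (M : FiniteMDP nS nA)
    (Q₀ : Fin nS → Fin nA → ℝ) (s : ℕ → Fin nS) (a : ℕ → Fin nA) :
    ℕ → Fin nS → Fin nA → ℝ
  | 0 => Q₀
  | t + 1 => qStep α γ (qTable α γ M Q₀ s a t) (s t) (a t) (M.r (s t) (a t)) (s (t + 1))

/-! ### The residual stream -/

/-- Coordinates of the stream `ℝ^d`, `d = 3 d_TE + d_PE`: three token blocks
(0 = identity, 1 = first buffer, 2 = second buffer) and the positional block. -/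
abbrev Coord (dTE dPE : ℕ) : Type := (Fin 3 × Fin dTE) ⊕ Fin dPE

/-- Vectors of the residual stream. -/
abbrev Vec (dTE dPE : ℕ) : Type := Coord dTE dPE → ℝ

/-- The identity block of a stream vector. -/
def idBlock {dTE dPE : ℕ} (x : Vec dTE dPE) : Fin dTE → ℝ := fun k => x (Sum.inl (0, k))

/-- The stream vector with the given token blocks and zero positional block. -/
def ofBlocks {dTE dPE : ℕ} (i b₁ b₂ : Fin dTE → ℝ) : Vec dTE dPE :=
  Sum.elim (fun p => ![i, b₁, b₂] p.1 p.2) (fun _ => 0)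

/-! ### Causal transformers -/

/-- Softmax attention or linear attention. -/
inductive HeadKind where
  | softmax
  | linear

/-- The inverse temperature of the softmax heads: a real number, or the limit `β → ∞`. -/
inductive InvTemp where
  | finite (β : ℝ)
  | infinite

/-- The positions `j ≤ i` at which the score is maximal. -/
def argmaxPos (score : ℕ → ℝ) (i : ℕ) : Finset ℕ :=
  open Classical in (Finset.range (i + 1)).filter (fun j => ∀ k ∈ Finset.range (i + 1), score k ≤ score j)

/-- The weight that position `i` gives to position `j ≤ i`, from the scores `⟨q_i, k_j⟩`.
At infinite inverse temperature this is the limit of the softmax: uniform on the maximisers. -/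
def attnWeight (β : InvTemp) (kind : HeadKind) (score : ℕ → ℝ) (i j : ℕ) : ℝ :=
  match kind, β with
  | .linear, _ => score j
  | .softmax, .finite b =>
      Real.exp (b * score j) / ∑ k ∈ Finset.range (i + 1), Real.exp (b * score k)
  | .softmax, .infinite =>
      if j ∈ argmaxPos score i then ((argmaxPos score i).card : ℝ)⁻¹ else 0

/-- An attention head with its query, key, value and output matrices. -/
structure Head (dTE dPE : ℕ) where
  kind : HeadKind
  WQ : Matrix (Coord dTE dPE) (Coord dTE dPE) ℝ
  WK : Matrix (Coord dTE dPE) (Coord dTE dPE) ℝ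
  WV : Matrix (Coord dTE dPE) (Coord dTE dPE) ℝ
  WO : Matrix (Coord dTE dPE) (Coord dTE dPE) ℝ

/-- Causal attention. A sequence of stream vectors is a function on all positions `0, 1, 2, …`;
position `i` reads only the positions `j ≤ i`, so values past the end of an input are never
used. -/
def Head.apply {dTE dPE : ℕ} (m : Head dTE dPE) (β : InvTemp) (h : ℕ → Vec dTE dPE) (i : ℕ) :
    Vec dTE dPE :=
  m.WO *ᵥ ∑ j ∈ Finset.range (i + 1),
    attnWeight β m.kind (fun k => (m.WQ *ᵥ h i) ⬝ᵥ (m.WK *ᵥ h k)) i j • (m.WV *ᵥ h j)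

/-- A layer: attention heads, then the tokenwise block `post` (the MLP followed by the
normalisation). -/
structure Layer (dTE dPE : ℕ) where
  heads : List (Head dTE dPE)
  post : Vec dTE dPE → Vec dTE dPE

/-- The residual stream plus the sum of the heads, followed by the tokenwise block. -/
def Layer.apply {dTE dPE : ℕ} (l : Layer dTE dPE) (β : InvTemp) (h : ℕ → Vec dTE dPE) :
    ℕ → Vec dTE dPE :=
  fun i => l.post (h i + (l.heads.map (fun m => m.apply β h i)).sum)

/-- The parameters of a transformer: an absolute positional encoding, with values in the
positional block, and the layers. -/
structure Transformer (dTE dPE : ℕ) where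
  pe : ℕ → Fin dPE → ℝ
  layers : List (Layer dTE dPE)

/-- The stream entering the first layer: input embedding plus positional encoding. -/
def Transformer.embed {dTE dPE : ℕ} (θ : Transformer dTE dPE) (x : List (Vec dTE dPE)) :
    ℕ → Vec dTE dPE :=
  fun i => x.getD i 0 + Sum.elim (fun _ => 0) (θ.pe (i + 1))

/-- The output on `x`: the last-layer vector at the last position. -/
def Transformer.output {dTE dPE : ℕ} (θ : Transformer dTE dPE) (β : InvTemp)
    (x : List (Vec dTE dPE)) : Vec dTE dPE :=
  (θ.layers.foldl (fun h l => l.apply β h) (θ.embed x)) (x.length - 1)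

/-! ### Tokens -/

/-- The vocabulary. -/
inductive Vocab (nS nA : ℕ) where
  | bos
  | reward
  | select
  | qcurr
  | qnext
  | update
  | state (s : Fin nS)
  | action (a : Fin nA)
  deriving DecidableEq

/-- The columns `ũ_v` of `U` are orthonormal. -/
def TokenOrthonormal {nS nA dTE : ℕ} (U : Matrix (Fin dTE) (Vocab nS nA) ℝ) : Prop :=
  Uᵀ * U = 1

/-- The identity embedding `ũ_v`. -/
def emb {nS nA dTE : ℕ} (U : Matrix (Fin dTE) (Vocab nS nA) ℝ) (v : Vocab nS nA) : Fin dTE → ℝ :=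
  fun k => U k v

/-- A plain token: identity `ũ_v`, empty buffers. -/
def tok {nS nA dTE : ℕ} (dPE : ℕ) (U : Matrix (Fin dTE) (Vocab nS nA) ℝ) (v : Vocab nS nA) :
    Vec dTE dPE :=
  ofBlocks (emb U v) 0 0

/-- The reward token: identity `ũ_r`, first buffer `r ũ_r`. -/
def rewardTok {nS nA dTE : ℕ} (dPE : ℕ) (U : Matrix (Fin dTE) (Vocab nS nA) ℝ) (r : ℝ) :
    Vec dTE dPE :=
  ofBlocks (emb U .reward) (r • emb U .reward) 0

/-- The context token of action `b`: identity `ũ_b + ũ_Update`, first buffer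
`∑_s Q(s,b) ũ_s`. -/
def ctxTok {nS nA dTE : ℕ} (dPE : ℕ) (U : Matrix (Fin dTE) (Vocab nS nA) ℝ)
    (Q : Fin nS → Fin nA → ℝ) (b : Fin nA) : Vec dTE dPE :=
  ofBlocks (emb U (.action b) + emb U .update) (∑ s, Q s b • emb U (.state s)) 0

/-- The input of one Q-learning step up to the `Select` token:
`BOS c_1 … c_n  Q_curr s a r Q_next s' (s' a_1) … (s' a_n) Select`. -/
def evalSeq {nS nA dTE dPE : ℕ} (U : Matrix (Fin dTE) (Vocab nS nA) ℝ)
    (c : Fin nA → Vec dTE dPE) (s : Fin nS) (a : Fin nA) (r : ℝ) (s' : Fin nS) :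
    List (Vec dTE dPE) :=
  [tok dPE U .bos] ++ List.ofFn c ++
  [tok dPE U .qcurr, tok dPE U (.state s), tok dPE U (.action a), rewardTok dPE U r,
    tok dPE U .qnext, tok dPE U (.state s')] ++
  (List.finRange nA).flatMap (fun i => [tok dPE U (.state s'), tok dPE U (.action i)]) ++
  [tok dPE U .select]

/-- The whole input of one Q-learning step: the evaluation part, then `a* Update`. -/
def stepSeq {nS nA dTE dPE : ℕ} (U : Matrix (Fin dTE) (Vocab nS nA) ℝ)
    (c : Fin nA → Vec dTE dPE) (s : Fin nS) (a : Fin nA) (r : ℝ) (s' : Fin nS)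
    (aStar : Fin nA) : List (Vec dTE dPE) :=
  evalSeq U c s a r s' ++ [tok dPE U (.action aStar), tok dPE U .update]

/-! ### The autoregressive run -/

/-- `dec` decodes an output vector to an action with the largest logit `⟨ũ_b, id(x)⟩`
(ties broken arbitrarily). -/
def IsDecoder {nS nA dTE dPE : ℕ} (U : Matrix (Fin dTE) (Vocab nS nA) ℝ)
    (dec : Vec dTE dPE → Fin nA) : Prop :=
  ∀ x b, emb U (.action b) ⬝ᵥ idBlock x ≤ emb U (.action (dec x)) ⬝ᵥ idBlock x

/-- The action `a*` that the model emits at `Select`. -/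
def emitAction {nS nA dTE dPE : ℕ} (U : Matrix (Fin dTE) (Vocab nS nA) ℝ)
    (θ : Transformer dTE dPE) (β : InvTemp) (dec : Vec dTE dPE → Fin nA)
    (c : Fin nA → Vec dTE dPE) (s : Fin nS) (a : Fin nA) (r : ℝ) (s' : Fin nS) : Fin nA :=
  dec (θ.output β (evalSeq U c s a r s'))

/-- The continuous thought that the model emits at `Update`, after its own `a*`. -/
def emitThought {nS nA dTE dPE : ℕ} (U : Matrix (Fin dTE) (Vocab nS nA) ℝ)
    (θ : Transformer dTE dPE) (β : InvTemp) (dec : Vec dTE dPE → Fin nA)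
    (c : Fin nA → Vec dTE dPE) (s : Fin nS) (a : Fin nA) (r : ℝ) (s' : Fin nS) :
    Vec dTE dPE :=
  θ.output β (stepSeq U c s a r s' (emitAction U θ β dec c s a r s'))

/-- The context tokens along a trajectory: they start as the encoding of `Q₀`, and at each step
the full output vector at `Update` replaces the context token of the visited action. -/
def context {nS nA dTE dPE : ℕ} (U : Matrix (Fin dTE) (Vocab nS nA) ℝ)
    (θ : Transformer dTE dPE) (β : InvTemp) (dec : Vec dTE dPE → Fin nA)
    (M : FiniteMDP nS nA) (Q₀ : Fin nS → Fin nA → ℝ) (s : ℕ → Fin nS) (a : ℕ → Fin nA) :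
    ℕ → Fin nA → Vec dTE dPE
  | 0 => ctxTok dPE U Q₀
  | t + 1 =>
      Function.update (context U θ β dec M Q₀ s a t) (a t)
        (emitThought U θ β dec (context U θ β dec M Q₀ s a t)
          (s t) (a t) (M.r (s t) (a t)) (s (t + 1)))

/-- The action `a*_t` emitted at step `t` of the run. -/
def runAction {nS nA dTE dPE : ℕ} (U : Matrix (Fin dTE) (Vocab nS nA) ℝ)
    (θ : Transformer dTE dPE) (β : InvTemp) (dec : Vec dTE dPE → Fin nA)
    (M : FiniteMDP nS nA) (Q₀ : Fin nS → Fin nA → ℝ) (s : ℕ → Fin nS) (a : ℕ → Fin nA)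
    (t : ℕ) : Fin nA :=
  emitAction U θ β dec (context U θ β dec M Q₀ s a t)
    (s t) (a t) (M.r (s t) (a t)) (s (t + 1))

end QTransformer

end

/-! The update is polynomial in the data except for the maximum, so linear attention computes
everything else exactly. The positional encoding marks the transition tokens, the next state,
`Select` and `Update`, and the rest of the positional block serves as scratch registers. The first
layer copies the transition to `Update` and the next state `s'` to `Select`. In the second, linear
heads retrieve the row of the current action and write the logits `Q(s', b)`, while a softmax head
scores the context token of `b` by `Q(s', b)` and averages the rows. The `s'` component of that
average is the softmax mean of the scores, an estimate of `max_b Q(s', b)`. Since bilinear scores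
can multiply two registers at `Update`, the third layer forms the temporal difference, adds it to
the entry of `s`, and erases the positional block. The fourth layer is empty.

Hence at every temperature the output is exactly a context token (`qTransformer_output_stepSeq`),
and the run follows Q-learning with the maximum replaced by `nextValue` (`context_qTransformer`). No
error leaves the space of encoded tables, so only two tables have to be compared.

Positions outside the context have score 0, and `Q ≥ 0`, which the recursion preserves, keeps them
from exceeding the maximum. In the limit the estimate is therefore exact. At finite `β` its error is
at most `(3 * nA + 10) / β` whatever the size of `Q`, because `y ≤ exp y`. The discount `γ < 1`
prevents a one-step error `δ` from accumulating beyond `δ / (1 - γ)`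
(`abs_softTable_sub_qTable_le`), uniformly in time and in `Q₀`. -/

noncomputable section

namespace QTransformer

/-! ### Attention heads from bilinear scores -/

/-- The head with score `B (h i) (h j)` and value `v (h j)`. -/
def Head.ofBilin {dTE dPE : ℕ} (kind : HeadKind)
    (B : Vec dTE dPE →ₗ[ℝ] Vec dTE dPE →ₗ[ℝ] ℝ) (v : Vec dTE dPE →ₗ[ℝ] Vec dTE dPE) :
    Head dTE dPE where
  kind := kind
  WQ := 1
  WK := LinearMap.toMatrix₂' ℝ B
  WV := LinearMap.toMatrix' v
  WO := 1

theorem Head.ofBilin_apply {dTE dPE : ℕ} (kind : HeadKind)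
    (B : Vec dTE dPE →ₗ[ℝ] Vec dTE dPE →ₗ[ℝ] ℝ) (v : Vec dTE dPE →ₗ[ℝ] Vec dTE dPE)
    (β : InvTemp) (h : ℕ → Vec dTE dPE) (i : ℕ) :
    (Head.ofBilin kind B v).apply β h i =
      ∑ j ∈ Finset.range (i + 1), attnWeight β kind (fun k => B (h i) (h k)) i j • v (h j) := by
  have hB : ∀ x y, x ⬝ᵥ (LinearMap.toMatrix₂' ℝ B *ᵥ y) = B x y := by
    intro x y
    rw [← Matrix.toLinearMap₂'_apply', Matrix.toLinearMap₂'_toMatrix']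
  simp [Head.apply, Head.ofBilin, hB, LinearMap.toMatrix'_mulVec]

theorem Head.ofBilin_linear_apply {dTE dPE : ℕ}
    (B : Vec dTE dPE →ₗ[ℝ] Vec dTE dPE →ₗ[ℝ] ℝ) (v : Vec dTE dPE →ₗ[ℝ] Vec dTE dPE)
    (β : InvTemp) (h : ℕ → Vec dTE dPE) (i : ℕ) :
    (Head.ofBilin .linear B v).apply β h i =
      ∑ j ∈ Finset.range (i + 1), B (h i) (h j) • v (h j) := by
  simp [Head.ofBilin_apply, attnWeight]

/-- A functional that vanishes on the values of a head vanishes on its output. -/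
theorem Head.map_ofBilin_apply_eq_zero {dTE dPE : ℕ} (kind : HeadKind)
    (B : Vec dTE dPE →ₗ[ℝ] Vec dTE dPE →ₗ[ℝ] ℝ) (v : Vec dTE dPE →ₗ[ℝ] Vec dTE dPE)
    (β : InvTemp) (h : ℕ → Vec dTE dPE) (i : ℕ) (f : Vec dTE dPE →ₗ[ℝ] ℝ)
    (hf : ∀ x, f (v x) = 0) : f ((Head.ofBilin kind B v).apply β h i) = 0 := by
  simp [Head.ofBilin_apply, hf]

/-! ### Reading and writing the residual stream -/

/-- Scratch coordinates in the positional block: markers of positions, and registers holding the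
transition, a row of the table and a mixture of rows. -/
inductive Slot (nS nA : ℕ) where
  | markUpdate
  | markSelect
  | markCurr
  | markNext
  | reward
  | state (s : Fin nS)
  | next (s : Fin nS)
  | query (s : Fin nS)
  | row (s : Fin nS)
  | mix (s : Fin nS)
  | action (a : Fin nA)
  deriving DecidableEq, Fintype

/-- The dimension of the positional block. -/
abbrev slotDim (nS nA : ℕ) : ℕ := Fintype.card (Slot nS nA)

/-- The stream of the construction. -/
abbrev Stream (dTE nS nA : ℕ) : Type := Vec dTE (slotDim nS nA)

section ReadWrite

variable {nS nA dTE : ℕ}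

/-- The component of the identity block along `ũ_v`. -/
def readId (U : Matrix (Fin dTE) (Vocab nS nA) ℝ) (v : Vocab nS nA) :
    Stream dTE nS nA →ₗ[ℝ] ℝ where
  toFun h := emb U v ⬝ᵥ idBlock h
  map_add' x y := by
    rw [← dotProduct_add]; rfl
  map_smul' c x := by
    rw [RingHom.id_apply, ← dotProduct_smul]; rfl

/-- The component of the first buffer along `ũ_v`. -/
def readBuf (U : Matrix (Fin dTE) (Vocab nS nA) ℝ) (v : Vocab nS nA) :
    Stream dTE nS nA →ₗ[ℝ] ℝ where
  toFun h := emb U v ⬝ᵥ fun k => h (Sum.inl (1, k))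
  map_add' x y := by
    rw [← dotProduct_add]; rfl
  map_smul' c x := by
    rw [RingHom.id_apply, ← dotProduct_smul]; rfl

/-- The content of a scratch coordinate. -/
def readSlot (j : Slot nS nA) : Stream dTE nS nA →ₗ[ℝ] ℝ :=
  LinearMap.proj (Sum.inr (Fintype.equivFin (Slot nS nA) j))

/-- `ũ_v` in the identity block. -/
def writeId (U : Matrix (Fin dTE) (Vocab nS nA) ℝ) (v : Vocab nS nA) : Stream dTE nS nA :=
  ofBlocks (emb U v) 0 0

/-- `ũ_v` in the first buffer. -/
def writeBuf (U : Matrix (Fin dTE) (Vocab nS nA) ℝ) (v : Vocab nS nA) : Stream dTE nS nA :=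
  ofBlocks 0 (emb U v) 0

/-- The unit vector of a scratch coordinate. -/
def writeSlot (j : Slot nS nA) : Stream dTE nS nA :=
  Pi.single (Sum.inr (Fintype.equivFin (Slot nS nA) j)) 1

/-- The projection to the positional block. -/
def posPart : Stream dTE nS nA →ₗ[ℝ] Stream dTE nS nA where
  toFun h := Sum.elim (fun _ => 0) (fun k => h (Sum.inr k))
  map_add' x y := by ext (p | k) <;> simp
  map_smul' c x := by ext (p | k) <;> simp

theorem emb_dotProduct_emb {U : Matrix (Fin dTE) (Vocab nS nA) ℝ} (hU : TokenOrthonormal U)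
    (v w : Vocab nS nA) : emb U v ⬝ᵥ emb U w = if v = w then 1 else 0 := by
  have := congrFun (congrFun hU v) w
  rw [Matrix.one_apply] at this
  rw [← this]; rfl

theorem readId_writeId {U : Matrix (Fin dTE) (Vocab nS nA) ℝ} (hU : TokenOrthonormal U)
    (v w : Vocab nS nA) : readId U v (writeId U w) = if v = w then 1 else 0 :=
  emb_dotProduct_emb hU v w

theorem readBuf_writeBuf {U : Matrix (Fin dTE) (Vocab nS nA) ℝ} (hU : TokenOrthonormal U)
    (v w : Vocab nS nA) : readBuf U v (writeBuf U w) = if v = w then 1 else 0 :=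
  emb_dotProduct_emb hU v w

variable (U : Matrix (Fin dTE) (Vocab nS nA) ℝ)

@[simp] theorem readId_writeBuf (v w : Vocab nS nA) : readId U v (writeBuf U w) = 0 := by
  simp [readId, writeBuf, ofBlocks, idBlock, dotProduct]

@[simp] theorem readBuf_writeId (v w : Vocab nS nA) : readBuf U v (writeId U w) = 0 := by
  simp [readBuf, writeId, ofBlocks, dotProduct]

@[simp] theorem readId_writeSlot (v : Vocab nS nA) (j : Slot nS nA) :
    readId U v (writeSlot j) = 0 := by
  simp [readId, writeSlot, idBlock, dotProduct]

@[simp] theorem readBuf_writeSlot (v : Vocab nS nA) (j : Slot nS nA) :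
    readBuf U v (writeSlot j) = 0 := by
  simp [readBuf, writeSlot, dotProduct]

@[simp] theorem readSlot_writeId (j : Slot nS nA) (v : Vocab nS nA) :
    readSlot j (writeId U v) = 0 := rfl

@[simp] theorem readSlot_writeBuf (j : Slot nS nA) (v : Vocab nS nA) :
    readSlot j (writeBuf U v) = 0 := rfl

@[simp] theorem readSlot_writeSlot (j k : Slot nS nA) :
    readSlot j (writeSlot k : Stream dTE nS nA) = if j = k then 1 else 0 := by
  simp [readSlot, writeSlot, Pi.single_apply]

@[simp] theorem posPart_writeId (v : Vocab nS nA) : posPart (writeId U v) = 0 := by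
  ext (p | k) <;> simp [posPart, writeId, ofBlocks]

@[simp] theorem posPart_writeBuf (v : Vocab nS nA) : posPart (writeBuf U v) = 0 := by
  ext (p | k) <;> simp [posPart, writeBuf, ofBlocks]

@[simp] theorem posPart_writeSlot (j : Slot nS nA) :
    posPart (writeSlot j : Stream dTE nS nA) = writeSlot j := by
  ext (p | k) <;> simp [posPart, writeSlot, Pi.single_apply]

@[simp] theorem readId_posPart (v : Vocab nS nA) (x : Stream dTE nS nA) :
    readId U v (posPart x) = 0 := by
  simp [readId, posPart, idBlock, dotProduct]

theorem tok_eq (v : Vocab nS nA) : tok (slotDim nS nA) U v = writeId U v := rfl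

theorem rewardTok_eq (r : ℝ) :
    rewardTok (slotDim nS nA) U r = writeId U .reward + r • writeBuf U .reward := by
  ext (⟨p, k⟩ | k)
  · fin_cases p <;> simp [rewardTok, writeId, writeBuf, ofBlocks]
  · simp [rewardTok, writeId, writeBuf, ofBlocks]

theorem ctxTok_eq (Q : Fin nS → Fin nA → ℝ) (b : Fin nA) :
    ctxTok (slotDim nS nA) U Q b =
      writeId U (.action b) + writeId U .update + ∑ s, Q s b • writeBuf U (.state s) := by
  ext (⟨p, k⟩ | k)
  · fin_cases p <;> simp [ctxTok, writeId, writeBuf, ofBlocks]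
  · simp [ctxTok, writeId, writeBuf, ofBlocks]

end ReadWrite

/-! ### The transformer -/

section Construction

variable {nS nA dTE : ℕ} (U : Matrix (Fin dTE) (Vocab nS nA) ℝ)

/-- Copies the current transition to the position of `Update`. -/
def currHead : Head dTE (slotDim nS nA) :=
  .ofBilin .linear
    ((readSlot .markUpdate).smulRight (readSlot .markCurr))
    (∑ x, (readId U (.state x)).smulRight (writeSlot (.state x)) +
      ∑ b, (readId U (.action b)).smulRight (writeId U (.action b) + writeSlot (.action b)) +
      (readBuf U .reward).smulRight (writeSlot .reward))

/-- Copies the next state to the position of `Update`. -/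
def nextHead : Head dTE (slotDim nS nA) :=
  .ofBilin .linear
    ((readSlot .markUpdate).smulRight (readSlot .markNext))
    (∑ x, (readId U (.state x)).smulRight (writeSlot (.next x)))

/-- Copies the next state to the position of `Select`. -/
def queryHead : Head dTE (slotDim nS nA) :=
  .ofBilin .linear
    ((readSlot .markSelect).smulRight (readSlot .markNext))
    (∑ x, (readId U (.state x)).smulRight (writeSlot (.query x)))

/-- Retrieves the row of the current action. -/
def rowHead : Head dTE (slotDim nS nA) :=
  .ofBilin .linear
    (∑ b, (readSlot (.action b)).smulRight (readId U (.action b)))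
    (∑ x, (readBuf U (.state x)).smulRight (writeBuf U (.state x) + writeSlot (.row x)))

/-- Mixes the rows according to their values at the next state. -/
def mixHead : Head dTE (slotDim nS nA) :=
  .ofBilin .softmax
    (∑ x, (readSlot (.next x)).smulRight (readBuf U (.state x)))
    (∑ x, (readBuf U (.state x)).smulRight (writeSlot (.mix x)))

/-- Writes the values at the next state as action logits. -/
def logitHead : Head dTE (slotDim nS nA) :=
  .ofBilin .linear
    (∑ x, (readSlot (.query x)).smulRight (readBuf U (.state x)))
    (∑ b, (readId U (.action b)).smulRight (writeId U (.action b)))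

/-- Adds the temporal difference to the entry of the current state. -/
def tdHead (α γ : ℝ) : Head dTE (slotDim nS nA) :=
  .ofBilin .linear
    -- With query and key both at `Update`, the key marker acts as the constant 1, and products with
    -- the one-hot registers of the next and the current state select one component of the mixture
    -- and of the row.
    (α • ((readSlot .reward).smulRight (readSlot .markUpdate) +
      γ • ∑ x, (readSlot (.mix x)).smulRight (readSlot (.next x)) -
      ∑ x, (readSlot (.row x)).smulRight (readSlot (.state x))))
    (∑ x, (readSlot (.state x)).smulRight (writeBuf U (.state x)))

/-- Erases the positional block at the position of `Update`. -/
def eraseHead : Head dTE (slotDim nS nA) :=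
  .ofBilin .linear
    ((readSlot .markUpdate).smulRight (readSlot .markUpdate)) (-posPart)

/-- The marker of each (zero-based) position. -/
def marker (nS nA i : ℕ) : Stream dTE nS nA :=
  (if i = 3 * nA + 9 then (1 : ℝ) else 0) • writeSlot .markUpdate +
  (if i = 3 * nA + 7 then (1 : ℝ) else 0) • writeSlot .markSelect +
  (if i ∈ ({nA + 2, nA + 3, nA + 4} : Finset ℕ) then (1 : ℝ) else 0) • writeSlot .markCurr +
  (if i = nA + 6 then (1 : ℝ) else 0) • writeSlot .markNext

/-- The transformer that performs tabular Q-learning. -/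
def qTransformer (α γ : ℝ) : Transformer dTE (slotDim nS nA) where
  -- The encoding of zero-based position `i` is `pe (i + 1)`, hence the shift.
  pe i := fun k => (marker nS nA (i - 1) : Stream dTE nS nA) (Sum.inr k)
  layers :=
    [⟨[currHead U, nextHead U, queryHead U], id⟩, ⟨[rowHead U, mixHead U, logitHead U], id⟩,
      ⟨[tdHead U α γ, eraseHead], id⟩, ⟨[], id⟩]

end Construction

/-! ### The stream, layer by layer -/

section Evaluation

variable {nS nA dTE : ℕ} {U : Matrix (Fin dTE) (Vocab nS nA) ℝ}

/-- The contents of the context tokens at the state `x`, by position. -/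
def contextScore (Q : Fin nS → Fin nA → ℝ) (x : Fin nS) (j : ℕ) : ℝ :=
  ∑ b : Fin nA, if j = (b : ℕ) + 1 then Q x b else 0

/-- The features of the inputs of one Q-learning step on which the construction relies. -/
structure IsStepInput (U : Matrix (Fin dTE) (Vocab nS nA) ℝ) (Q : Fin nS → Fin nA → ℝ)
    (s : Fin nS) (a : Fin nA) (r : ℝ) (s' : Fin nS) (X : ℕ → Stream dTE nS nA) : Prop where
  slot : ∀ k j, readSlot k (X j) = 0
  buf : ∀ x j, readBuf U (.state x) (X j) = contextScore Q x j
  ctx : ∀ b b' : Fin nA, readId U (.action b') (X (b + 1)) = if b' = b then 1 else 0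
  state : X (nA + 2) = writeId U (.state s)
  action : X (nA + 3) = writeId U (.action a)
  reward : X (nA + 4) = writeId U .reward + r • writeBuf U .reward
  next : X (nA + 6) = writeId U (.state s')

theorem readSlot_marker_update (i : ℕ) :
    readSlot .markUpdate (marker nS nA i : Stream dTE nS nA) =
      if i = 3 * nA + 9 then 1 else 0 := by
  simp only [marker, map_add, map_smul]
  simp

theorem readSlot_marker_select (i : ℕ) :
    readSlot .markSelect (marker nS nA i : Stream dTE nS nA) =
      if i = 3 * nA + 7 then 1 else 0 := by
  simp only [marker, map_add, map_smul]
  simp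

theorem readSlot_marker_curr (i : ℕ) :
    readSlot .markCurr (marker nS nA i : Stream dTE nS nA) =
      if i ∈ ({nA + 2, nA + 3, nA + 4} : Finset ℕ) then 1 else 0 := by
  simp only [marker, map_add, map_smul, readSlot_writeSlot]
  simp

theorem readSlot_marker_next (i : ℕ) :
    readSlot .markNext (marker nS nA i : Stream dTE nS nA) =
      if i = nA + 6 then 1 else 0 := by
  simp only [marker, map_add, map_smul]
  simp

@[simp] theorem readBuf_marker (v : Vocab nS nA) (i : ℕ) :
    readBuf U v (marker nS nA i) = 0 := by
  simp only [marker, map_add, map_smul]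
  simp

@[simp] theorem readId_marker (v : Vocab nS nA) (i : ℕ) :
    readId U v (marker nS nA i) = 0 := by
  simp only [marker, map_add, map_smul]
  simp

theorem readSlot_marker_state (x : Fin nS) (i : ℕ) :
    readSlot (.state x) (marker nS nA i : Stream dTE nS nA) = 0 := by
  simp only [marker, map_add, map_smul]
  simp

theorem qTransformer_embed (α γ : ℝ) (x : List (Stream dTE nS nA)) (i : ℕ) :
    (qTransformer U α γ).embed x i = x.getD i 0 + marker nS nA i := by
  ext (⟨p, k⟩ | k)
  · simp only [Transformer.embed, marker, writeSlot, Pi.add_apply, Pi.smul_apply]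
    simp
  · simp [Transformer.embed, qTransformer]

/-- The first layer of the construction. -/
def gatherLayer (U : Matrix (Fin dTE) (Vocab nS nA) ℝ) : Layer dTE (slotDim nS nA) :=
  ⟨[currHead U, nextHead U, queryHead U], id⟩

/-- The second layer of the construction. -/
def lookupLayer (U : Matrix (Fin dTE) (Vocab nS nA) ℝ) : Layer dTE (slotDim nS nA) :=
  ⟨[rowHead U, mixHead U, logitHead U], id⟩

/-- The third layer of the construction. -/
def writeLayer (U : Matrix (Fin dTE) (Vocab nS nA) ℝ) (α γ : ℝ) : Layer dTE (slotDim nS nA) :=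
  ⟨[tdHead U α γ, eraseHead], id⟩

theorem lookupLayer_apply (β : InvTemp) (h : ℕ → Stream dTE nS nA) (i : ℕ) :
    (lookupLayer U).apply β h i = h i + (rowHead U).apply β h i + (mixHead U).apply β h i +
      (logitHead U).apply β h i := by
  simp [lookupLayer, Layer.apply, add_assoc]

theorem writeLayer_apply (α γ : ℝ) (β : InvTemp) (h : ℕ → Stream dTE nS nA) (i : ℕ) :
    (writeLayer U α γ).apply β h i = h i + (tdHead U α γ).apply β h i +
      (eraseHead : Head dTE (slotDim nS nA)).apply β h i := by
  simp [writeLayer, Layer.apply, add_assoc]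

variable {Q : Fin nS → Fin nA → ℝ} {s s' : Fin nS} {a : Fin nA} {r : ℝ}
  {X : ℕ → Stream dTE nS nA}

/-- The queries of the first layer are the markers of `Update` and `Select`, so every score vanishes
at other positions. -/
theorem gatherLayer_apply_of_ne (hX : IsStepInput U Q s a r s' X) (β : InvTemp) {i : ℕ}
    (hi : i ≠ 3 * nA + 9) (hi' : i ≠ 3 * nA + 7) :
    (gatherLayer U).apply β (fun j => X j + marker nS nA j) i = X i + marker nS nA i := by
  simp [gatherLayer, Layer.apply, currHead, nextHead, queryHead, Head.ofBilin_linear_apply,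
    hX.slot, readSlot_marker_update, readSlot_marker_select, hi, hi']

/-- Each of the three marked transition tokens activates its own summand of the value map. The
identity block already becomes that of the context token of `a`. -/
theorem gatherLayer_apply_update (hU : TokenOrthonormal U) (hX : IsStepInput U Q s a r s' X)
    (β : InvTemp) (hlast : X (3 * nA + 9) = writeId U .update) :
    (gatherLayer U).apply β (fun j => X j + marker nS nA j) (3 * nA + 9) =
      writeId U .update + writeSlot .markUpdate + writeSlot (.state s) +
        writeId U (.action a) + writeSlot (.action a) + r • writeSlot .reward +
        writeSlot (.next s') := by
  have hsub : Finset.range (3 * nA + 9 + 1) ∩ {nA + 2, nA + 3, nA + 4} =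
      {nA + 2, nA + 3, nA + 4} := by
    rw [Finset.inter_eq_right]
    intro x hx
    simp only [Finset.mem_insert, Finset.mem_singleton] at hx
    rw [Finset.mem_range]
    omega
  have hm : (marker nS nA (3 * nA + 9) : Stream dTE nS nA) = writeSlot .markUpdate := by
    have h1 : ¬ (3 * nA + 9 = nA + 2) := by omega
    have h2 : ¬ (3 * nA + 9 = nA + 3) := by omega
    have h3 : ¬ (3 * nA + 9 = nA + 4) := by omega
    have h4 : ¬ (3 * nA + 9 = nA + 6) := by omega
    simp [marker, h1, h2, h3, h4]
  have hn : nA + 6 < 3 * nA + 9 + 1 := by omega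
  simp only [gatherLayer, Layer.apply, currHead, nextHead, queryHead, Head.ofBilin_linear_apply,
    List.map_cons, List.map_nil, List.sum_cons, List.sum_nil, id_eq, LinearMap.smulRight_apply,
    map_add, hX.slot, readSlot_marker_update, readSlot_marker_select,
    readSlot_marker_curr, readSlot_marker_next, zero_add, if_true,
    ite_smul, one_smul, zero_smul, Finset.sum_ite_mem, hsub, Finset.sum_ite_eq', Finset.mem_range,
    hn]
  rw [Finset.sum_insert (by simp), Finset.sum_insert (by simp), Finset.sum_singleton]
  simp [hX.state, hX.action, hX.reward, hX.next, hlast, hm, readId_writeId hU,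
    readBuf_writeBuf hU, Finset.sum_add_distrib]
  abel

theorem gatherLayer_apply_select (hU : TokenOrthonormal U) (hX : IsStepInput U Q s a r s' X)
    (β : InvTemp) (hsel : X (3 * nA + 7) = writeId U .select) :
    (gatherLayer U).apply β (fun j => X j + marker nS nA j) (3 * nA + 7) =
      writeId U .select + marker nS nA (3 * nA + 7) + writeSlot (.query s') := by
  have hn : nA + 6 < 3 * nA + 7 + 1 := by omega
  simp only [gatherLayer, Layer.apply, currHead, nextHead, queryHead, Head.ofBilin_linear_apply,
    List.map_cons, List.map_nil, List.sum_cons, List.sum_nil, id_eq, LinearMap.smulRight_apply,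
    map_add, hX.slot, readSlot_marker_update, readSlot_marker_select,
    readSlot_marker_next, zero_add, if_true,
    ite_smul, one_smul, zero_smul, Finset.sum_ite_eq', Finset.mem_range, hn]
  simp [hX.next, hsel, readId_writeId hU]

/-- No head of the first layer writes to the first buffer, so along state directions it still holds
the table and nothing else. -/
theorem readBuf_gatherLayer (hX : IsStepInput U Q s a r s' X) (β : InvTemp)
    (x : Fin nS) (i : ℕ) :
    readBuf U (.state x) ((gatherLayer U).apply β (fun j => X j + marker nS nA j) i) =
      contextScore Q x i := by
  simp [gatherLayer, Layer.apply, currHead, nextHead, queryHead, Head.ofBilin_linear_apply, hX.buf]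

theorem readId_gatherLayer_context (hX : IsStepInput U Q s a r s' X) (β : InvTemp)
    (b b' : Fin nA) :
    readId U (.action b')
      ((gatherLayer U).apply β (fun j => X j + marker nS nA j) (b + 1)) =
      if b' = b then 1 else 0 := by
  rw [gatherLayer_apply_of_ne hX β (by omega) (by omega)]
  simp [hX.ctx]

theorem readSlot_state_gatherLayer (hX : IsStepInput U Q s a r s' X) (β : InvTemp)
    (x : Fin nS) {i : ℕ} (hi : i ≠ 3 * nA + 9) :
    readSlot (.state x) ((gatherLayer U).apply β (fun j => X j + marker nS nA j) i) = 0 := by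
  simp [gatherLayer, Layer.apply, currHead, nextHead, queryHead, Head.ofBilin_linear_apply,
    hX.slot, readSlot_marker_update, hi, readSlot_marker_state]

theorem readSlot_update_gatherLayer (hX : IsStepInput U Q s a r s' X) (β : InvTemp) (i : ℕ) :
    readSlot .markUpdate ((gatherLayer U).apply β (fun j => X j + marker nS nA j) i) =
      if i = 3 * nA + 9 then 1 else 0 := by
  simp [gatherLayer, Layer.apply, currHead, nextHead, queryHead, Head.ofBilin_linear_apply,
    hX.slot, readSlot_marker_update]

/-- The weight of position `j` at `Update` in the mixture of rows. -/
def mixWeight (β : InvTemp) (Q : Fin nS → Fin nA → ℝ) (s' : Fin nS) (j : ℕ) : ℝ :=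
  attnWeight β .softmax (contextScore Q s') (3 * nA + 9) j

/-- Turns attention over positions into a sum over actions; the shift by one is due to `BOS`. -/
theorem sum_contextScore_smul {V : Type*} [AddCommGroup V] [Module ℝ V]
    (Q : Fin nS → Fin nA → ℝ) (x : Fin nS) {n : ℕ} (hn : nA < n) (f : ℕ → V) :
    ∑ j ∈ Finset.range n, contextScore Q x j • f j = ∑ b : Fin nA, Q x b • f (b + 1) := by
  simp only [contextScore, Finset.sum_smul]
  rw [Finset.sum_comm]
  refine Finset.sum_congr rfl fun b _ => ?_
  have : (b : ℕ) + 1 < n := by omega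
  simp [ite_smul, this]

/-- The stream at `Update` after the second layer. -/
theorem lookupLayer_apply_update (hU : TokenOrthonormal U) (hX : IsStepInput U Q s a r s' X)
    (β : InvTemp) (hlast : X (3 * nA + 9) = writeId U .update) :
    (lookupLayer U).apply β ((gatherLayer U).apply β (fun j => X j + marker nS nA j))
        (3 * nA + 9) =
      writeId U .update + writeSlot .markUpdate + writeSlot (.state s) +
        writeId U (.action a) + writeSlot (.action a) + r • writeSlot .reward +
        writeSlot (.next s') +
        ∑ x, Q x a • (writeBuf U (.state x) + writeSlot (.row x)) +
        ∑ x, (∑ j ∈ Finset.range (3 * nA + 9 + 1), mixWeight β Q s' j * contextScore Q x j) •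
          writeSlot (.mix x) := by
  have hrow : (rowHead U).apply β
      ((gatherLayer U).apply β (fun j => X j + marker nS nA j)) (3 * nA + 9) =
      ∑ x, Q x a • (writeBuf U (.state x) + writeSlot (.row x)) := by
    simp only [rowHead, Head.ofBilin_linear_apply, LinearMap.sum_apply, LinearMap.smulRight_apply,
      LinearMap.smul_apply, readBuf_gatherLayer hX, gatherLayer_apply_update hU hX β hlast]
    simp only [Finset.smul_sum]
    rw [Finset.sum_comm]
    refine Finset.sum_congr rfl fun x _ => ?_
    -- Action tokens after the context also match the query, but their buffer content `contextScore`
    -- is zero; it is moved outside to act as the weight.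
    simp only [smul_comm _ (contextScore Q x _)]
    rw [sum_contextScore_smul Q x (by omega)]
    simp [readId_gatherLayer_context hX, Finset.sum_add_distrib]
  have hmix : (mixHead U).apply β
      ((gatherLayer U).apply β (fun j => X j + marker nS nA j)) (3 * nA + 9) =
      ∑ x, (∑ j ∈ Finset.range (3 * nA + 9 + 1), mixWeight β Q s' j * contextScore Q x j) •
          writeSlot (.mix x) := by
    simp only [mixHead, Head.ofBilin_apply, LinearMap.sum_apply, LinearMap.smulRight_apply,
      LinearMap.smul_apply, readBuf_gatherLayer hX, gatherLayer_apply_update hU hX β hlast]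
    simp only [Finset.smul_sum, Finset.sum_smul, smul_smul]
    rw [Finset.sum_comm]
    refine Finset.sum_congr rfl fun x _ => Finset.sum_congr rfl fun j _ => ?_
    simp [mixWeight]
  have hlogit : (logitHead U).apply β
      ((gatherLayer U).apply β (fun j => X j + marker nS nA j)) (3 * nA + 9) = 0 := by
    simp [logitHead, Head.ofBilin_linear_apply, gatherLayer_apply_update hU hX β hlast]
  rw [lookupLayer_apply, hrow, hmix, hlogit, gatherLayer_apply_update hU hX β hlast]
  abel

/-- Only the linear logit head writes to the identity block in this layer, so the logits are exact
at every temperature. -/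
theorem readId_lookupLayer_select (hU : TokenOrthonormal U) (hX : IsStepInput U Q s a r s' X)
    (β : InvTemp) (hsel : X (3 * nA + 7) = writeId U .select) (b : Fin nA) :
    readId U (.action b) ((lookupLayer U).apply β
      ((gatherLayer U).apply β (fun j => X j + marker nS nA j)) (3 * nA + 7)) = Q s' b := by
  have hlogit : (logitHead U).apply β
      ((gatherLayer U).apply β (fun j => X j + marker nS nA j)) (3 * nA + 7) =
      ∑ b, Q s' b • writeId U (.action b) := by
    have hq (x : Fin nS) : readSlot (.query x)
        (marker nS nA (3 * nA + 7) : Stream dTE nS nA) = 0 := by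
      simp only [marker, map_add, map_smul]
      simp
    have hB (j : ℕ) : (∑ x, (readSlot (.query x)).smulRight (readBuf U (.state x)))
        ((gatherLayer U).apply β (fun j => X j + marker nS nA j) (3 * nA + 7))
        ((gatherLayer U).apply β (fun j => X j + marker nS nA j) j) = contextScore Q s' j := by
      simp [gatherLayer_apply_select hU hX β hsel, hq, readBuf_gatherLayer hX]
    rw [logitHead, Head.ofBilin_linear_apply]
    simp only [hB]
    rw [sum_contextScore_smul Q s' (by omega)]
    simp [readId_gatherLayer_context hX]
  have hrow := Head.map_ofBilin_apply_eq_zero .linear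
    (∑ b, (readSlot (.action b)).smulRight (readId U (.action b)))
    (∑ x, (readBuf U (.state x)).smulRight (writeBuf U (.state x) + writeSlot (.row x)))
    β ((gatherLayer U).apply β (fun j => X j + marker nS nA j)) (3 * nA + 7)
    (readId U (.action b)) (by simp)
  have hmix := Head.map_ofBilin_apply_eq_zero .softmax
    (∑ x, (readSlot (.next x)).smulRight (readBuf U (.state x)))
    (∑ x, (readBuf U (.state x)).smulRight (writeSlot (.mix x)))
    β ((gatherLayer U).apply β (fun j => X j + marker nS nA j)) (3 * nA + 7)
    (readId U (.action b)) (by simp)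
  rw [lookupLayer_apply, map_add, map_add, map_add, hlogit, rowHead, hrow, mixHead, hmix,
    gatherLayer_apply_select hU hX β hsel]
  simp [readId_writeId hU]

/-- The second layer leaves unchanged every scratch coordinate to which its heads do not write. -/
theorem readSlot_lookupLayer (β : InvTemp) (h : ℕ → Stream dTE nS nA) (i : ℕ) {k : Slot nS nA}
    (hrow : ∀ x, k ≠ .row x) (hmix : ∀ x, k ≠ .mix x) :
    readSlot k ((lookupLayer U).apply β h i) = readSlot k (h i) := by
  rw [lookupLayer_apply, map_add, map_add, map_add, rowHead, mixHead, logitHead,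
    Head.map_ofBilin_apply_eq_zero, Head.map_ofBilin_apply_eq_zero,
    Head.map_ofBilin_apply_eq_zero, add_zero, add_zero, add_zero]
  · simp
  · simp [hmix]
  · simp [hrow]

/-- The estimate of `max_b Q(s', b)` formed by the softmax head. -/
def nextValue (β : InvTemp) (Q : Fin nS → Fin nA → ℝ) (s' : Fin nS) : ℝ :=
  ∑ j ∈ Finset.range (3 * nA + 9 + 1), mixWeight β Q s' j * contextScore Q s' j

/-- A Q-learning step with the estimate `v` of the value of the next state. -/
def stepWith (α γ v : ℝ) (Q : Fin nS → Fin nA → ℝ) (s : Fin nS) (a : Fin nA) (r : ℝ) :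
    Fin nS → Fin nA → ℝ :=
  fun x b => if x = s ∧ b = a then Q s a + α * (r + γ * v - Q s a) else Q x b

theorem writeLayer_apply_update (hU : TokenOrthonormal U) (hX : IsStepInput U Q s a r s' X)
    (α γ : ℝ) (β : InvTemp) (hlast : X (3 * nA + 9) = writeId U .update) :
    (writeLayer U α γ).apply β ((lookupLayer U).apply β
        ((gatherLayer U).apply β (fun j => X j + marker nS nA j))) (3 * nA + 9) =
      ctxTok (slotDim nS nA) U (stepWith α γ (nextValue β Q s') Q s a r) a := by
  set h := (lookupLayer U).apply β
    ((gatherLayer U).apply β (fun j => X j + marker nS nA j)) with hh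
  have hlook := lookupLayer_apply_update hU hX β hlast
  rw [← hh] at hlook
  have htd : (tdHead U α γ).apply β h (3 * nA + 9) =
      (α * (r + γ * nextValue β Q s' - Q s a)) • writeBuf U (.state s) := by
    -- The value map reads the current-state registers, which are empty away from `Update`; scores
    -- elsewhere do not matter.
    rw [tdHead, Head.ofBilin_linear_apply, Finset.sum_eq_single (3 * nA + 9)]
    · simp [hlook, nextValue, Finset.sum_add_distrib]
    · intro j _ hj
      have (x : Fin nS) : readSlot (.state x) (h j) = 0 := by
        rw [hh, readSlot_lookupLayer _ _ _ (by simp) (by simp),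
          readSlot_state_gatherLayer hX β x hj]
      simp [this]
    · simp
  have herase : (eraseHead : Head dTE (slotDim nS nA)).apply β h (3 * nA + 9) =
      -posPart (h (3 * nA + 9)) := by
    have hm (j : ℕ) : readSlot .markUpdate (h j) = if j = 3 * nA + 9 then 1 else 0 := by
      rw [hh, readSlot_lookupLayer _ _ _ (by simp) (by simp), readSlot_update_gatherLayer hX]
    simp [eraseHead, Head.ofBilin_linear_apply, hm]
  have hQ : ∑ x, stepWith α γ (nextValue β Q s') Q s a r x a • writeBuf U (.state x) =
      ∑ x, Q x a • writeBuf U (.state x) +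
        (α * (r + γ * nextValue β Q s' - Q s a)) • writeBuf U (.state s) := by
    have : (α * (r + γ * nextValue β Q s' - Q s a)) • writeBuf U (.state s) =
        ∑ x, if x = s then
          (α * (r + γ * nextValue β Q s' - Q s a)) • writeBuf U (.state x) else 0 := by
      simp
    rw [this, ← Finset.sum_add_distrib]
    refine Finset.sum_congr rfl fun x _ => ?_
    by_cases hx : x = s
    · simp [stepWith, hx, add_smul]
    · simp [stepWith, hx]
  rw [writeLayer_apply, htd, herase, hlook, ctxTok_eq, hQ]
  simp [Finset.sum_add_distrib]
  abel

theorem readId_writeLayer (α γ : ℝ) (β : InvTemp) (h : ℕ → Stream dTE nS nA) (i : ℕ)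
    (v : Vocab nS nA) :
    readId U v ((writeLayer U α γ).apply β h i) = readId U v (h i) := by
  rw [writeLayer_apply, map_add, map_add, tdHead, eraseHead, Head.map_ofBilin_apply_eq_zero,
    Head.map_ofBilin_apply_eq_zero, add_zero, add_zero]
  · simp
  · simp

end Evaluation

/-! ### Token positions and the output of the whole network -/

section Inputs

variable {nS nA dTE : ℕ}

theorem evalSeq_length (U : Matrix (Fin dTE) (Vocab nS nA) ℝ) (c : Fin nA → Stream dTE nS nA)
    (s : Fin nS) (a : Fin nA) (r : ℝ) (s' : Fin nS) :
    (evalSeq U c s a r s').length = 3 * nA + 8 := by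
  simp [evalSeq]
  omega

/-- The part of the input that follows the context tokens. -/
def transitionSeq (U : Matrix (Fin dTE) (Vocab nS nA) ℝ) (s : Fin nS) (a : Fin nA) (r : ℝ)
    (s' : Fin nS) (l : List (Stream dTE nS nA)) : List (Stream dTE nS nA) :=
  [tok _ U .qcurr, tok _ U (.state s), tok _ U (.action a), rewardTok _ U r,
    tok _ U .qnext, tok _ U (.state s')] ++
  (List.finRange nA).flatMap (fun i => [tok _ U (.state s'), tok _ U (.action i)]) ++
  ([tok _ U .select] ++ l)

theorem evalSeq_append (U : Matrix (Fin dTE) (Vocab nS nA) ℝ) (c : Fin nA → Stream dTE nS nA)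
    (s : Fin nS) (a : Fin nA) (r : ℝ) (s' : Fin nS) (l : List (Stream dTE nS nA)) :
    evalSeq U c s a r s' ++ l =
      ([tok _ U .bos] ++ List.ofFn c) ++ transitionSeq U s a r s' l := by
  simp [evalSeq, transitionSeq]

theorem getD_evalSeq_append_of_lt (U : Matrix (Fin dTE) (Vocab nS nA) ℝ)
    (c : Fin nA → Stream dTE nS nA) (s : Fin nS) (a : Fin nA) (r : ℝ) (s' : Fin nS)
    (l : List (Stream dTE nS nA)) (b : Fin nA) :
    (evalSeq U c s a r s' ++ l).getD (b + 1) 0 = c b := by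
  rw [evalSeq_append, List.getD_append _ _ _ _ (by simp)]
  simp

theorem getD_evalSeq_append_add (U : Matrix (Fin dTE) (Vocab nS nA) ℝ)
    (c : Fin nA → Stream dTE nS nA) (s : Fin nS) (a : Fin nA) (r : ℝ) (s' : Fin nS)
    (l : List (Stream dTE nS nA)) (k : ℕ) :
    (evalSeq U c s a r s' ++ l).getD (nA + 1 + k) 0 = (transitionSeq U s a r s' l).getD k 0 := by
  rw [evalSeq_append, List.getD_append_right _ _ _ _ (by simp)]
  simp

theorem getD_transitionSeq_tail (U : Matrix (Fin dTE) (Vocab nS nA) ℝ) (s : Fin nS) (a : Fin nA)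
    (r : ℝ) (s' : Fin nS) (l : List (Stream dTE nS nA)) (k : ℕ) :
    (transitionSeq U s a r s' l).getD (2 * nA + 6 + k) 0 =
      ([tok _ U .select] ++ l).getD k 0 := by
  have : ([tok (slotDim nS nA) U .qcurr, tok _ U (.state s), tok _ U (.action a), rewardTok _ U r,
    tok _ U .qnext, tok _ U (.state s')] ++ (List.finRange nA).flatMap
      (fun i => [tok _ U (.state s'), tok _ U (.action i)])).length = 2 * nA + 6 := by
    simp; omega
  rw [transitionSeq, List.getD_append_right _ _ _ _ (by omega), this]
  congr 1
  omega

theorem getD_eq_or_mem {V : Type*} (l : List V) (k : ℕ) (d : V) :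
    l.getD k d = d ∨ l.getD k d ∈ l := by
  by_cases hk : k < l.length
  · rw [List.getD_eq_getElem _ _ hk]
    exact Or.inr (List.getElem_mem hk)
  · exact Or.inl (List.getD_eq_default _ _ (by omega))

variable {U : Matrix (Fin dTE) (Vocab nS nA) ℝ}

/-- The tail `l` is empty for the output at `Select` and consists of `a*` and `Update` for the
output at `Update`; being plain tokens, they add nothing to the buffers. -/
theorem isStepInput_getD (hU : TokenOrthonormal U) (Q : Fin nS → Fin nA → ℝ) (s : Fin nS)
    (a : Fin nA) (r : ℝ) (s' : Fin nS) {l : List (Stream dTE nS nA)}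
    (hl : ∀ x ∈ l, ∃ v, x = tok (slotDim nS nA) U v) :
    IsStepInput U Q s a r s'
      (fun j => (evalSeq U (ctxTok (slotDim nS nA) U Q) s a r s' ++ l).getD j 0) := by
  have htrans : ∀ x ∈ transitionSeq U s a r s' l,
      (∃ v, x = tok (slotDim nS nA) U v) ∨ x = rewardTok (slotDim nS nA) U r := by
    intro x hx
    simp only [transitionSeq, List.mem_append, List.mem_cons, List.not_mem_nil, or_false,
      List.mem_flatMap, List.mem_finRange, true_and] at hx
    rcases hx with ((rfl | rfl | rfl | rfl | rfl | rfl) | ⟨i, rfl | rfl⟩) | rfl | hx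
    all_goals first | exact Or.inr rfl | exact Or.inl ⟨_, rfl⟩ | exact Or.inl (hl x hx)
  have hcases : ∀ j : ℕ, (j = 0 ∨ ∃ b : Fin nA, j = (b : ℕ) + 1) ∨ ∃ k, j = nA + 1 + k := by
    intro j
    by_cases hj : j < nA + 1
    · left
      rcases j with _ | j
      · exact Or.inl rfl
      · exact Or.inr ⟨⟨j, by omega⟩, rfl⟩
    · exact Or.inr ⟨j - (nA + 1), by omega⟩
  have hzero : (evalSeq U (ctxTok (slotDim nS nA) U Q) s a r s' ++ l).getD 0 0 =
      tok (slotDim nS nA) U .bos := by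
    simp [evalSeq]
  refine ⟨fun k j => ?_, fun x j => ?_, fun b b' => ?_, ?_, ?_, ?_, ?_⟩
  · rcases hcases j with (rfl | ⟨b, rfl⟩) | ⟨m, rfl⟩
    · rw [hzero, tok_eq, readSlot_writeId]
    · rw [getD_evalSeq_append_of_lt, ctxTok_eq]
      simp
    · rw [getD_evalSeq_append_add]
      rcases getD_eq_or_mem (transitionSeq U s a r s' l) m 0 with h | h
      · rw [h, map_zero]
      · rcases htrans _ h with ⟨v, hv⟩ | hv
        · rw [hv, tok_eq, readSlot_writeId]
        · rw [hv, rewardTok_eq]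
          simp
  · rcases hcases j with (rfl | ⟨b, rfl⟩) | ⟨m, rfl⟩
    · rw [hzero, tok_eq, readBuf_writeId]
      simp [contextScore]
    · rw [getD_evalSeq_append_of_lt, ctxTok_eq]
      simp [contextScore, readBuf_writeBuf hU, Fin.val_inj]
    · have : contextScore Q x (nA + 1 + m) = 0 := by
        refine Finset.sum_eq_zero fun b _ => if_neg ?_
        omega
      rw [getD_evalSeq_append_add, this]
      rcases getD_eq_or_mem (transitionSeq U s a r s' l) m 0 with h | h
      · rw [h, map_zero]
      · rcases htrans _ h with ⟨v, hv⟩ | hv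
        · rw [hv, tok_eq, readBuf_writeId]
        · rw [hv, rewardTok_eq]
          simp [readBuf_writeBuf hU]
  · rw [getD_evalSeq_append_of_lt, ctxTok_eq]
    simp [readId_writeId hU]
  · exact getD_evalSeq_append_add U _ s a r s' l 1
  · exact getD_evalSeq_append_add U _ s a r s' l 2
  · exact (getD_evalSeq_append_add U _ s a r s' l 3).trans (rewardTok_eq U r)
  · exact getD_evalSeq_append_add U _ s a r s' l 5

theorem getD_evalSeq_append_select (c : Fin nA → Stream dTE nS nA) (s : Fin nS) (a : Fin nA)
    (r : ℝ) (s' : Fin nS) (l : List (Stream dTE nS nA)) (k : ℕ) :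
    (evalSeq U c s a r s' ++ l).getD (3 * nA + 7 + k) 0 =
      ([tok _ U .select] ++ l).getD k 0 := by
  have : 3 * nA + 7 + k = nA + 1 + (2 * nA + 6 + k) := by ring
  rw [this, getD_evalSeq_append_add, getD_transitionSeq_tail]

theorem qTransformer_output (α γ : ℝ) (β : InvTemp) (x : List (Stream dTE nS nA)) :
    (qTransformer U α γ).output β x =
      (writeLayer U α γ).apply β ((lookupLayer U).apply β ((gatherLayer U).apply β
        (fun j => x.getD j 0 + marker nS nA j))) (x.length - 1) := by
  have : (qTransformer U α γ).embed x = fun j => x.getD j 0 + marker nS nA j :=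
    funext (qTransformer_embed α γ x)
  rw [Transformer.output, this]
  simp [qTransformer, gatherLayer, lookupLayer, writeLayer, Layer.apply]

/-- The thought emitted at `Update` encodes the updated table, with the softmax estimate in place
of the maximum. -/
theorem qTransformer_output_stepSeq (hU : TokenOrthonormal U) (α γ : ℝ) (β : InvTemp)
    (Q : Fin nS → Fin nA → ℝ) (s : Fin nS) (a : Fin nA) (r : ℝ) (s' : Fin nS) (b : Fin nA) :
    (qTransformer U α γ).output β (stepSeq U (ctxTok (slotDim nS nA) U Q) s a r s' b) =
      ctxTok (slotDim nS nA) U (stepWith α γ (nextValue β Q s') Q s a r) a := by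
  have hlen : (stepSeq U (ctxTok (slotDim nS nA) U Q) s a r s' b).length - 1 = 3 * nA + 9 := by
    simp [stepSeq, evalSeq_length]
  rw [qTransformer_output, hlen, stepSeq]
  refine writeLayer_apply_update hU (isStepInput_getD hU Q s a r s' ?_) α γ β ?_
  · intro x hx
    simp only [List.mem_cons, List.not_mem_nil, or_false] at hx
    rcases hx with rfl | rfl
    · exact ⟨_, rfl⟩
    · exact ⟨_, rfl⟩
  -- Counted from `Select`, `a*` has offset 1 and `Update` offset 2.
  · exact getD_evalSeq_append_select _ s a r s' _ 2

/-- The logits at `Select` are the values at the next state. -/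
theorem readId_qTransformer_output_evalSeq (hU : TokenOrthonormal U) (α γ : ℝ) (β : InvTemp)
    (Q : Fin nS → Fin nA → ℝ) (s : Fin nS) (a : Fin nA) (r : ℝ) (s' : Fin nS) (b : Fin nA) :
    readId U (.action b)
      ((qTransformer U α γ).output β (evalSeq U (ctxTok (slotDim nS nA) U Q) s a r s')) =
      Q s' b := by
  have hX := isStepInput_getD hU Q s a r s' (l := []) (by simp)
  have hsel := getD_evalSeq_append_select (U := U) (ctxTok (slotDim nS nA) U Q) s a r s' [] 0
  rw [List.append_nil] at hsel
  simp only [List.append_nil] at hX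
  have hlen : (evalSeq U (ctxTok (slotDim nS nA) U Q) s a r s').length - 1 = 3 * nA + 7 := by
    simp [evalSeq_length]
  rw [qTransformer_output, hlen, readId_writeLayer]
  exact readId_lookupLayer_select hU hX β hsel b

end Inputs

/-! ### The softmax estimate of a maximum -/

section Softmax

/-- Ties are harmless: the uniform average runs over positions that all carry the maximal value. -/
theorem sum_attnWeight_infinite_mul {x : ℕ → ℝ} {i m : ℕ} (hm : m ≤ i)
    (hmax : ∀ k ≤ i, x k ≤ x m) :
    ∑ j ∈ Finset.range (i + 1), attnWeight .infinite .softmax x i j * x j = x m := by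
  have hmem : m ∈ argmaxPos x i := by
    simp only [argmaxPos, Finset.mem_filter, Finset.mem_range]
    exact ⟨by omega, fun k hk => hmax k (by omega)⟩
  have hsub : argmaxPos x i ⊆ Finset.range (i + 1) := by
    intro j hj
    simp only [argmaxPos, Finset.mem_filter] at hj
    exact hj.1
  have hval : ∀ j ∈ argmaxPos x i, x j = x m := by
    intro j hj
    simp only [argmaxPos, Finset.mem_filter, Finset.mem_range] at hj
    exact le_antisymm (hmax j (by omega)) (hj.2 m (by omega))
  have hcard : ((argmaxPos x i).card : ℝ) ≠ 0 := by
    exact_mod_cast Finset.card_ne_zero_of_mem hmem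
  simp only [attnWeight, ite_mul, zero_mul]
  rw [Finset.sum_ite_mem, Finset.inter_eq_right.mpr hsub,
    Finset.sum_congr rfl fun j hj => by rw [hval j hj], Finset.sum_const, nsmul_eq_mul,
    ← mul_assoc, mul_inv_cancel₀ hcard, one_mul]

theorem sum_attnWeight_finite {x : ℕ → ℝ} (i : ℕ) (β : ℝ) :
    ∑ j ∈ Finset.range (i + 1), attnWeight (.finite β) .softmax x i j = 1 := by
  simp only [attnWeight]
  rw [← Finset.sum_div]
  exact div_self (Finset.sum_pos (fun _ _ => Real.exp_pos _) ⟨0, by simp⟩).ne'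

theorem attnWeight_finite_nonneg (x : ℕ → ℝ) (i j : ℕ) (β : ℝ) :
    0 ≤ attnWeight (.finite β) .softmax x i j :=
  div_nonneg (Real.exp_pos _).le (Finset.sum_nonneg fun _ _ => (Real.exp_pos _).le)

/-- The softmax average falls short of the maximum by at most `(number of terms) / β`, whatever
the size of the terms. -/
theorem sub_sum_attnWeight_finite_mul_le {x : ℕ → ℝ} {i m : ℕ} (hm : m ≤ i) {β : ℝ}
    (hβ : 0 < β) :
    x m - ∑ j ∈ Finset.range (i + 1), attnWeight (.finite β) .softmax x i j * x j ≤
      (i + 1) / β := by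
  have hterm : ∀ j ∈ Finset.range (i + 1),
      attnWeight (.finite β) .softmax x i j * (x m - x j) ≤ 1 / β := by
    intro j hj
    have hle : Real.exp (β * x m) ≤ ∑ k ∈ Finset.range (i + 1), Real.exp (β * x k) :=
      Finset.single_le_sum (f := fun k => Real.exp (β * x k))
        (fun _ _ => (Real.exp_pos _).le) (Finset.mem_range.mpr (by omega))
    have hpos : 0 < ∑ k ∈ Finset.range (i + 1), Real.exp (β * x k) :=
      (Real.exp_pos _).trans_le hle
    -- With `y = β * (x m - x j)`, the bound `y ≤ exp y` makes each term of the deficit at most `1 /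
    -- β`, however large the gap.
    have hexp : Real.exp (β * x j) * (β * (x m - x j)) ≤ Real.exp (β * x m) := by
      have h1 : β * (x m - x j) ≤ Real.exp (β * (x m - x j)) := by
        linarith [Real.add_one_le_exp (β * (x m - x j))]
      calc _ ≤ Real.exp (β * x j) * Real.exp (β * (x m - x j)) := by gcongr
        _ = Real.exp (β * x m) := by rw [← Real.exp_add]; ring_nf
    rw [attnWeight, div_mul_eq_mul_div, div_le_div_iff₀ hpos hβ]
    nlinarith
  calc _ = ∑ j ∈ Finset.range (i + 1),
        attnWeight (.finite β) .softmax x i j * (x m - x j) := by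
        simp only [mul_sub]
        rw [Finset.sum_sub_distrib, ← Finset.sum_mul, sum_attnWeight_finite, one_mul]
    _ ≤ ∑ j ∈ Finset.range (i + 1), 1 / β := Finset.sum_le_sum hterm
    _ = _ := by simp [div_eq_mul_inv]

theorem sum_attnWeight_finite_mul_le {x : ℕ → ℝ} {i : ℕ} {M : ℝ} (hmax : ∀ k ≤ i, x k ≤ M)
    (β : ℝ) :
    ∑ j ∈ Finset.range (i + 1), attnWeight (.finite β) .softmax x i j * x j ≤ M := by
  calc _ ≤ ∑ j ∈ Finset.range (i + 1), attnWeight (.finite β) .softmax x i j * M :=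
        Finset.sum_le_sum fun j hj => mul_le_mul_of_nonneg_left
          (hmax j (by have := Finset.mem_range.mp hj; omega)) (attnWeight_finite_nonneg _ _ _ _)
    _ = M := by rw [← Finset.sum_mul, sum_attnWeight_finite, one_mul]

variable {nS nA : ℕ} [NeZero nA]

omit [NeZero nA] in
theorem contextScore_succ (Q : Fin nS → Fin nA → ℝ) (x : Fin nS) (b : Fin nA) :
    contextScore Q x (b + 1) = Q x b := by
  simp [contextScore, Fin.val_inj]

omit [NeZero nA] in
theorem contextScore_nonneg {Q : Fin nS → Fin nA → ℝ} (hQ : ∀ x b, 0 ≤ Q x b) (x : Fin nS)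
    (j : ℕ) : 0 ≤ contextScore Q x j :=
  Finset.sum_nonneg fun b _ => by split_ifs; exacts [hQ x b, le_rfl]

theorem maxQ_nonneg {Q : Fin nS → Fin nA → ℝ} (hQ : ∀ x b, 0 ≤ Q x b) (x : Fin nS) :
    0 ≤ maxQ Q x :=
  (hQ x 0).trans (Finset.le_sup' (Q x) (Finset.mem_univ 0))

/-- Nonnegativity enters here: positions outside the context have score 0, which must not beat the
maximum. -/
theorem contextScore_le_maxQ {Q : Fin nS → Fin nA → ℝ} (hQ : ∀ x b, 0 ≤ Q x b) (x : Fin nS)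
    (j : ℕ) : contextScore Q x j ≤ maxQ Q x := by
  by_cases hj : ∃ b : Fin nA, j = (b : ℕ) + 1
  · obtain ⟨b, rfl⟩ := hj
    rw [contextScore_succ]
    exact Finset.le_sup' (Q x) (Finset.mem_univ b)
  · push Not at hj
    simpa [contextScore, hj] using maxQ_nonneg hQ x

theorem exists_contextScore_eq_maxQ (Q : Fin nS → Fin nA → ℝ) (x : Fin nS) :
    ∃ m ≤ 3 * nA + 9, contextScore Q x m = maxQ Q x := by
  obtain ⟨b, -, hb⟩ := Finset.exists_mem_eq_sup' Finset.univ_nonempty (Q x)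
  exact ⟨b + 1, by omega, (contextScore_succ Q x b).trans hb.symm⟩

theorem nextValue_infinite {Q : Fin nS → Fin nA → ℝ} (hQ : ∀ x b, 0 ≤ Q x b) (x : Fin nS) :
    nextValue .infinite Q x = maxQ Q x := by
  obtain ⟨m, hm, hmax⟩ := exists_contextScore_eq_maxQ Q x
  rw [← hmax]
  exact sum_attnWeight_infinite_mul hm fun k _ => hmax ▸ contextScore_le_maxQ hQ x k

theorem abs_nextValue_finite_sub_le {Q : Fin nS → Fin nA → ℝ} (hQ : ∀ x b, 0 ≤ Q x b)
    (x : Fin nS) {β : ℝ} (hβ : 0 < β) :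
    |nextValue (.finite β) Q x - maxQ Q x| ≤ (3 * nA + 10) / β := by
  obtain ⟨m, hm, hmax⟩ := exists_contextScore_eq_maxQ Q x
  have h1 := sub_sum_attnWeight_finite_mul_le (x := contextScore Q x) hm hβ
  have h2 : nextValue (.finite β) Q x ≤ maxQ Q x :=
    sum_attnWeight_finite_mul_le (fun k _ => contextScore_le_maxQ hQ x k) β
  have h3 : ((3 * nA + 9 : ℕ) : ℝ) + 1 = 3 * nA + 10 := by push_cast; ring
  rw [abs_of_nonpos (sub_nonpos.mpr h2), neg_sub, ← hmax, ← h3]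
  exact h1

theorem nextValue_nonneg {Q : Fin nS → Fin nA → ℝ} (hQ : ∀ x b, 0 ≤ Q x b)
    (x : Fin nS) (β : InvTemp) : 0 ≤ nextValue β Q x := by
  cases β with
  | infinite => exact nextValue_infinite hQ x ▸ maxQ_nonneg hQ x
  | finite β =>
    exact Finset.sum_nonneg fun j _ =>
      mul_nonneg (attnWeight_finite_nonneg _ _ _ _) (contextScore_nonneg hQ x j)

end Softmax

/-! ### The run -/

section Run

variable {nS nA dTE : ℕ} [NeZero nA]

/-- Q-learning with the softmax estimate in place of the maximum. -/
def softTable (α γ : ℝ) (β : InvTemp) (M : FiniteMDP nS nA) (Q₀ : Fin nS → Fin nA → ℝ)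
    (s : ℕ → Fin nS) (a : ℕ → Fin nA) : ℕ → Fin nS → Fin nA → ℝ
  | 0 => Q₀
  | t + 1 => stepWith α γ (nextValue β (softTable α γ β M Q₀ s a t) (s (t + 1)))
      (softTable α γ β M Q₀ s a t) (s t) (a t) (M.r (s t) (a t))

omit [NeZero nA] in
-- Each output is again exactly an encoded table, so induction on time needs no error term, even at
-- finite temperature.
theorem context_qTransformer {U : Matrix (Fin dTE) (Vocab nS nA) ℝ} (hU : TokenOrthonormal U)
    (α γ : ℝ) (β : InvTemp) (dec : Stream dTE nS nA → Fin nA) (M : FiniteMDP nS nA)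
    (Q₀ : Fin nS → Fin nA → ℝ) (s : ℕ → Fin nS) (a : ℕ → Fin nA) (t : ℕ) :
    context U (qTransformer U α γ) β dec M Q₀ s a t =
      ctxTok (slotDim nS nA) U (softTable α γ β M Q₀ s a t) := by
  induction t with
  | zero => rfl
  | succ t ih =>
    rw [context, ih, emitThought, qTransformer_output_stepSeq hU]
    funext b
    by_cases hb : b = a t
    · subst hb
      rw [Function.update_self]
      rfl
    · rw [Function.update_of_ne hb]
      simp [ctxTok_eq, softTable, stepWith, hb]

omit [NeZero nA] in
theorem softTable_runAction {U : Matrix (Fin dTE) (Vocab nS nA) ℝ} (hU : TokenOrthonormal U)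
    (α γ : ℝ) (β : InvTemp) {dec : Stream dTE nS nA → Fin nA} (hdec : IsDecoder U dec)
    (M : FiniteMDP nS nA) (Q₀ : Fin nS → Fin nA → ℝ) (s : ℕ → Fin nS) (a : ℕ → Fin nA) (t : ℕ)
    (b : Fin nA) :
    softTable α γ β M Q₀ s a t (s (t + 1)) b ≤ softTable α γ β M Q₀ s a t (s (t + 1))
      (runAction U (qTransformer U α γ) β dec M Q₀ s a t) := by
  rw [runAction, emitAction, context_qTransformer hU]
  have h := hdec ((qTransformer U α γ).output β
    (evalSeq U (ctxTok (slotDim nS nA) U (softTable α γ β M Q₀ s a t)) (s t) (a t)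
      (M.r (s t) (a t)) (s (t + 1)))) b
  have hread := readId_qTransformer_output_evalSeq hU α γ β (softTable α γ β M Q₀ s a t) (s t)
    (a t) (M.r (s t) (a t)) (s (t + 1))
  exact (hread b).symm.le.trans (h.trans (hread _).le)

/-- The updated entry is `(1 - α)` times the old one plus nonnegative terms. -/
theorem softTable_nonneg {α γ : ℝ} (hα : 0 < α) (hα1 : α ≤ 1) (hγ : 0 < γ) (β : InvTemp)
    (M : FiniteMDP nS nA) {Q₀ : Fin nS → Fin nA → ℝ} (hQ₀ : ∀ x b, 0 ≤ Q₀ x b)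
    (s : ℕ → Fin nS) (a : ℕ → Fin nA) (t : ℕ) (x : Fin nS) (b : Fin nA) :
    0 ≤ softTable α γ β M Q₀ s a t x b := by
  induction t generalizing x b with
  | zero => exact hQ₀ x b
  | succ t ih =>
    rw [softTable, stepWith]
    split_ifs
    · have h1 := mul_nonneg (sub_nonneg.mpr hα1) (ih (s t) (a t))
      have h2 := mul_nonneg hα.le (M.r_nonneg (s t) (a t))
      have h3 := mul_nonneg (mul_nonneg hα.le hγ.le) (nextValue_nonneg ih (s (t + 1)) β)
      linarith
    · exact ih x b

theorem abs_maxQ_sub_maxQ_le {Q Q' : Fin nS → Fin nA → ℝ} {e : ℝ} {x : Fin nS}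
    (h : ∀ b, |Q x b - Q' x b| ≤ e) : |maxQ Q x - maxQ Q' x| ≤ e := by
  rw [abs_sub_le_iff, sub_le_iff_le_add, sub_le_iff_le_add]
  constructor
  · refine Finset.sup'_le _ _ fun b _ => ?_
    linarith [(abs_sub_le_iff.mp (h b)).1, Finset.le_sup' (Q' x) (Finset.mem_univ b),
      maxQ.eq_1 Q' x]
  · refine Finset.sup'_le _ _ fun b _ => ?_
    linarith [(abs_sub_le_iff.mp (h b)).2, Finset.le_sup' (Q x) (Finset.mem_univ b),
      maxQ.eq_1 Q x]

/-- A uniform bound on the error of the estimate bounds the error of the table, uniformly in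
time. -/
theorem abs_softTable_sub_qTable_le {α γ : ℝ} (hα : 0 < α) (hα1 : α ≤ 1) (hγ : 0 < γ)
    (hγ1 : γ < 1) {β : InvTemp} {δ : ℝ} (hδ : 0 ≤ δ)
    (hβ : ∀ (Q : Fin nS → Fin nA → ℝ), (∀ x b, 0 ≤ Q x b) →
      ∀ x, |nextValue β Q x - maxQ Q x| ≤ δ)
    (M : FiniteMDP nS nA) {Q₀ : Fin nS → Fin nA → ℝ} (hQ₀ : ∀ x b, 0 ≤ Q₀ x b)
    (s : ℕ → Fin nS) (a : ℕ → Fin nA) (t : ℕ) (x : Fin nS) (b : Fin nA) :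
    |softTable α γ β M Q₀ s a t x b - qTable α γ M Q₀ s a t x b| ≤ δ / (1 - γ) := by
  have hpos : 0 < 1 - γ := sub_pos.mpr hγ1
  induction t generalizing x b with
  | zero => simpa [softTable, qTable] using div_nonneg hδ hpos.le
  | succ t ih =>
    rw [softTable, qTable, stepWith, qStep]
    split_ifs
    · set Q := softTable α γ β M Q₀ s a t
      set Q' := qTable α γ M Q₀ s a t
      set e := δ / (1 - γ) with he
      have hnext := hβ Q (softTable_nonneg hα hα1 hγ β M hQ₀ s a t) (s (t + 1))
      have hmax := abs_maxQ_sub_maxQ_le (fun b => ih (s (t + 1)) b)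
      have hv : |nextValue β Q (s (t + 1)) - maxQ Q' (s (t + 1))| ≤ δ + e :=
        (abs_sub_le _ (maxQ Q (s (t + 1))) _).trans (add_le_add hnext hmax)
      have hδe : δ = e * (1 - γ) := by rw [he, div_mul_cancel₀ _ hpos.ne']
      have hentry := ih (s t) (a t)
      -- The reward cancels, and the new error is at most `(1 - α) * e + α * γ * (δ + e)`, which
      -- does not exceed `e = δ / (1 - γ)`.
      have hsplit : Q (s t) (a t) + α * (M.r (s t) (a t) + γ * nextValue β Q (s (t + 1)) -
            Q (s t) (a t)) - (Q' (s t) (a t) + α * (M.r (s t) (a t) + γ * maxQ Q' (s (t + 1)) -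
            Q' (s t) (a t))) =
          (1 - α) * (Q (s t) (a t) - Q' (s t) (a t)) +
            α * γ * (nextValue β Q (s (t + 1)) - maxQ Q' (s (t + 1))) := by ring
      rw [hsplit]
      calc _ ≤ |(1 - α) * (Q (s t) (a t) - Q' (s t) (a t))| +
            |α * γ * (nextValue β Q (s (t + 1)) - maxQ Q' (s (t + 1)))| := abs_add_le _ _
        _ ≤ (1 - α) * e + α * γ * (δ + e) := by
            rw [abs_mul, abs_mul, abs_of_nonneg (sub_nonneg.mpr hα1),
              abs_of_nonneg (mul_nonneg hα.le hγ.le)]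
            have := sub_nonneg.mpr hα1
            gcongr
        _ ≤ e := by
            have : 0 ≤ α * (1 - γ) * δ := mul_nonneg (mul_nonneg hα.le hpos.le) hδ
            have h2 : e - ((1 - α) * e + α * γ * (δ + e)) = α * (1 - γ) * δ := by
              rw [show (1 - α) * e + α * γ * (δ + e) = e - α * (e * (1 - γ)) + α * γ * δ by ring,
                ← hδe]
              ring
            linarith
    · exact ih x b

/-- The error is paid twice: once at the true maximiser and once at the chosen action. -/
theorem maxQ_sub_le_of_near {Q Q' : Fin nS → Fin nA → ℝ} {e : ℝ} {x : Fin nS} {b : Fin nA}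
    (h : ∀ b, |Q x b - Q' x b| ≤ e) (hb : ∀ b', Q x b' ≤ Q x b) :
    maxQ Q' x - 2 * e ≤ Q' x b := by
  rw [sub_le_iff_le_add]
  refine Finset.sup'_le _ _ fun b' _ => ?_
  linarith [(abs_sub_le_iff.mp (h b)).1, (abs_sub_le_iff.mp (h b')).2, hb b']

omit [NeZero nA] in
-- Only the first buffer depends on the table. The factor depends on `U` alone, so it can be
-- absorbed into `β₀`.
theorem abs_ctxTok_sub_ctxTok_le (dPE : ℕ) (U : Matrix (Fin dTE) (Vocab nS nA) ℝ)
    {Q Q' : Fin nS → Fin nA → ℝ} {e : ℝ} (he : 0 ≤ e) {b : Fin nA}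
    (h : ∀ x, |Q x b - Q' x b| ≤ e) (k : Coord dTE dPE) :
    |ctxTok dPE U Q b k - ctxTok dPE U Q' b k| ≤ e * ∑ i, ∑ x, |U i (.state x)| := by
  have hsum : 0 ≤ e * ∑ i, ∑ x, |U i (.state x)| := by positivity
  rcases k with ⟨p, i⟩ | i
  · fin_cases p
    · simpa [ctxTok, ofBlocks] using hsum
    · have hdiff : ctxTok dPE U Q b (Sum.inl (1, i)) - ctxTok dPE U Q' b (Sum.inl (1, i)) =
          ∑ x, (Q x b - Q' x b) * U i (.state x) := by
        simp [ctxTok, ofBlocks, emb, sub_mul]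
      change |ctxTok dPE U Q b (Sum.inl (1, i)) - ctxTok dPE U Q' b (Sum.inl (1, i))| ≤ _
      rw [hdiff]
      calc _ ≤ ∑ x, |(Q x b - Q' x b) * U i (.state x)| := Finset.abs_sum_le_sum_abs _ _
        _ ≤ ∑ x, e * |U i (.state x)| := Finset.sum_le_sum fun x _ => by
            rw [abs_mul]
            exact mul_le_mul_of_nonneg_right (h x) (abs_nonneg _)
        _ = e * ∑ x, |U i (.state x)| := (Finset.mul_sum _ _ _).symm
        _ ≤ _ := mul_le_mul_of_nonneg_left
            (Finset.single_le_sum (f := fun i => ∑ x, |U i (.state x)|)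
              (fun _ _ => Finset.sum_nonneg fun _ _ => abs_nonneg _) (Finset.mem_univ i)) he
    · simpa [ctxTok, ofBlocks] using hsum
  · simpa [ctxTok, ofBlocks] using hsum

theorem exists_tokenOrthonormal (nS nA : ℕ) :
    ∃ U : Matrix (Fin (nS + nA + 6)) (Vocab nS nA) ℝ, TokenOrthonormal U := by
  let f : Vocab nS nA → Fin (nS + nA) ⊕ Fin 6
    | .state s => .inl (Fin.castAdd nA s)
    | .action a => .inl (Fin.natAdd nS a)
    | .bos => .inr 0
    | .reward => .inr 1
    | .select => .inr 2
    | .qcurr => .inr 3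
    | .qnext => .inr 4
    | .update => .inr 5
  have hf : Function.Injective f := by
    intro v w h
    cases v <;> cases w <;> simp_all [f, Fin.ext_iff] <;> omega
  let g : Vocab nS nA → Fin (nS + nA + 6) := finSumFinEquiv ∘ f
  have hg : Function.Injective g := finSumFinEquiv.injective.comp hf
  refine ⟨Matrix.of fun k v => if k = g v then 1 else 0, ?_⟩
  ext v w
  simp [Matrix.mul_apply, Matrix.one_apply, hg.eq_iff, eq_comm]

end Run

end QTransformer

end

theorem mainTheorem2 :
    ∃ C : ℕ, ∀ (nS nA : ℕ) [NeZero nA] (α γ : ℝ), 0 < α → α ≤ 1 → 0 < γ → γ < 1 →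
      ∃ dTE : ℕ, dTE ≤ C * (nS + nA) ∧
        (∃ U : Matrix (Fin dTE) (QTransformer.Vocab nS nA) ℝ, QTransformer.TokenOrthonormal U) ∧
        ∀ U : Matrix (Fin dTE) (QTransformer.Vocab nS nA) ℝ, QTransformer.TokenOrthonormal U →
          ∃ (dPE : ℕ) (θ : QTransformer.Transformer dTE dPE),
            θ.layers.length = 4 ∧
            (∀ l ∈ θ.layers, l.heads.length ≤ C ∧ l.post = id) ∧
            -- exact Q-learning in the limit of infinite inverse temperature
            (∀ (dec : QTransformer.Vec dTE dPE → Fin nA), QTransformer.IsDecoder U dec →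
              ∀ (M : QTransformer.FiniteMDP nS nA) (Q₀ : Fin nS → Fin nA → ℝ),
                (∀ x b, 0 ≤ Q₀ x b) →
              ∀ (s : ℕ → Fin nS) (a : ℕ → Fin nA), M.IsTrajectory s a → ∀ t : ℕ,
                (∀ b, QTransformer.context U θ .infinite dec M Q₀ s a t b =
                  QTransformer.ctxTok dPE U (QTransformer.qTable α γ M Q₀ s a t) b) ∧
                QTransformer.qTable α γ M Q₀ s a t (s (t + 1))
                    (QTransformer.runAction U θ .infinite dec M Q₀ s a t) =
                  QTransformer.maxQ (QTransformer.qTable α γ M Q₀ s a t) (s (t + 1))) ∧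
            -- the same parameters at large finite inverse temperature, uniformly in time
            (∀ ε : ℝ, 0 < ε → ∃ β₀ : ℝ, ∀ β : ℝ, β₀ ≤ β →
              ∀ (dec : QTransformer.Vec dTE dPE → Fin nA), QTransformer.IsDecoder U dec →
              ∀ (M : QTransformer.FiniteMDP nS nA) (Q₀ : Fin nS → Fin nA → ℝ),
                (∀ x b, 0 ≤ Q₀ x b) →
              ∀ (s : ℕ → Fin nS) (a : ℕ → Fin nA), M.IsTrajectory s a → ∀ t : ℕ,
                (∀ b k, |QTransformer.context U θ (.finite β) dec M Q₀ s a t b k -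
                  QTransformer.ctxTok dPE U (QTransformer.qTable α γ M Q₀ s a t) b k| ≤ ε) ∧
                QTransformer.maxQ (QTransformer.qTable α γ M Q₀ s a t) (s (t + 1)) - ε ≤
                  QTransformer.qTable α γ M Q₀ s a t (s (t + 1))
                    (QTransformer.runAction U θ (.finite β) dec M Q₀ s a t)) := by
  open QTransformer in
  -- The vocabulary has `nS + nA + 6` elements, at most `7 * (nS + nA)` because `nA ≥ 1`.
  refine ⟨7, fun nS nA _ α γ hα hα1 hγ hγ1 => ⟨nS + nA + 6, ?_, exists_tokenOrthonormal nS nA,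
    fun U hU => ⟨slotDim nS nA, qTransformer U α γ, rfl, ?_, ?_, ?_⟩⟩⟩
  · have := NeZero.pos nA
    omega
  · intro l hl
    simp only [qTransformer, List.mem_cons, List.not_mem_nil, or_false] at hl
    rcases hl with rfl | rfl | rfl | rfl <;> simp
  · intro dec hdec M Q₀ hQ₀ s a _ t
    -- This is the finite-temperature stability bound with `δ = 0`.
    have hsoft : softTable α γ .infinite M Q₀ s a t = qTable α γ M Q₀ s a t := by
      funext x b
      have h := abs_softTable_sub_qTable_le hα hα1 hγ hγ1 (β := .infinite) le_rfl
        (fun Q hQ x => by simp [nextValue_infinite hQ]) M hQ₀ s a t x b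
      rw [zero_div] at h
      exact sub_eq_zero.mp (abs_nonpos_iff.mp h)
    refine ⟨fun b => by rw [context_qTransformer hU, hsoft], le_antisymm ?_ ?_⟩
    · exact Finset.le_sup' (qTable α γ M Q₀ s a t (s (t + 1))) (Finset.mem_univ _)
    · refine Finset.sup'_le _ _ fun b _ => ?_
      rw [← hsoft]
      exact softTable_runAction hU α γ .infinite hdec M Q₀ s a t b
  · intro ε hε
    -- `K` dominates both losses: the factor 2 for the greedy action and the embedding sum for the
    -- coordinates. The choice of `β₀` below is equivalent to `e * K ≤ ε`.
    set K := 2 + ∑ i, ∑ x, |U i (.state x)| with hK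
    have hsum : 0 ≤ ∑ i, ∑ x, |U i (.state x)| := by positivity
    have hKpos : 0 < K := by linarith
    have hγ' : 0 < 1 - γ := sub_pos.mpr hγ1
    refine ⟨(3 * nA + 10) * K / (ε * (1 - γ)), fun β hβ dec hdec M Q₀ hQ₀ s a _ t => ?_⟩
    have hβpos : 0 < β := lt_of_lt_of_le (by positivity) hβ
    set e := (3 * nA + 10) / β / (1 - γ) with he
    have he0 : 0 ≤ e := by positivity
    have heε : e * K ≤ ε := by
      rw [div_le_iff₀ (mul_pos hε hγ')] at hβ
      rw [he, div_div, div_mul_eq_mul_div, div_le_iff₀ (mul_pos hβpos hγ')]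
      linarith
    have herr := abs_softTable_sub_qTable_le hα hα1 hγ hγ1 (β := .finite β) (by positivity)
      (fun Q hQ x => abs_nextValue_finite_sub_le hQ x hβpos) M hQ₀ s a t
    refine ⟨fun b k => ?_, ?_⟩
    · rw [context_qTransformer hU]
      refine (abs_ctxTok_sub_ctxTok_le _ U he0 (fun x => herr x b) k).trans ?_
      refine le_trans ?_ heε
      gcongr
      linarith
    · refine le_trans ?_ (maxQ_sub_le_of_near (herr (s (t + 1)))
        (softTable_runAction hU α γ (.finite β) hdec M Q₀ s a t))
      have h2 : e * 2 ≤ e * K := by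
        gcongr
        linarith
      change _ - ε ≤ _ - 2 * e
      linarith
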